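/- Let $c\ge 2$ and $p\ge 0$ be integers, let $P_X$ be a probability measure on $\mathbf{R}^p$ (with its Borel $\sigma$-algebra), and let $F$ be a cumulative distribution function on $\mathbf{R}$. Put $$\Theta=\{\theta=(\alpha,\beta)=(\alpha^2,\ldots,\alpha^{c-1},\beta)\in\mathbf{R}^{c-2}\times\mathbf{R}^p:\ 0<\alpha^2<\cdots<\alpha^{c-1}\}$$ (so $\theta=\beta$ and $\Theta=\mathbf{R}^p$ if $c=2$), and set $\alpha^0=-\infty$, $\alpha^1=0$, $\alpha^c=+\infty$, $F(-\infty)=0$, $F(+\infty)=1$. For $\theta\in\Theta$, let $P(dx\,dy|\theta)$ be the law on $\mathbf{R}^p\times\{1,\ldots,c\}$ given by the cumulative link model $$x\sim P_X(dx),\qquad P(y\le j|x)=F(\alpha^j+\beta^Tx)\quad(j=1,\ldots,c),$$ that is, the law with density $p(x,y|\theta)=F(\alpha^y+\beta^Tx)-F(\alpha^{y-1}+\beta^Tx)$ with respect to the product of $P_X$ and the counting measure on $\{1,\ldots,c\}$. Let $P_n(\cdot|\theta)=P(\cdot|\theta)^{\otimes n}$ be the law of $n$ independent observations $(x_n,y_n)=((x^1,\ldots,x^n),(y^1,\ldots,y^n))$.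 Assume: 1. $F(x)=\int_{-\infty}^x f(y)\,dy$ for all $x\in\mathbf{R}$, for a continuous strictly positive function $f$; 2. the support of the law of $\xi=(1,x^T)^T\in\mathbf{R}^{p+1}$, where $x\sim P_X$, is compact and is not included in any linear subspace of dimension strictly lower than $p+1$. Then, for every $\theta_0\in\Theta$ and every $\epsilon>0$, there exists a uniformly consistent test for $\theta_0$ against $B_\epsilon(\theta_0)^c=\{\theta\in\Theta:\ |\theta-\theta_0|\ge\epsilon\}$, where $|\cdot|$ is the Euclidean norm. That is, there are measurable functions $\psi_n:(\mathbf{R}^p)^n\times\{1,\ldots,c\}^n\to[0,1]$ such that $$\int\psi_n\,dP_n(\cdot|\theta_0)\to 0\quad\text{and}\quad\sup_{\theta\in B_\epsilon(\theta_0)^c}\int(1-\psi_n)\,dP_n(\cdot|\theta)\to 0\qquad(n\to\infty)$$ (a supremum over the empty set being $0$). -/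

import Mathlib

open MeasureTheory ProbabilityTheory Set Filter Topology

noncomputable section

namespace CumulativeLink

/-- The space `ℝ^(c-2) × ℝ^p` with its Euclidean norm; a point is `θ = (α, β)`, with
`θ.fst = (α², …, α^(c-1))` and `θ.snd = β`. -/
abbrev Param (c p : ℕ) : Type :=
  WithLp 2 (EuclideanSpace ℝ (Fin (c - 2)) × EuclideanSpace ℝ (Fin p))

/-- The parameter space `Θ`: those `(α, β)` with `0 < α² < ⋯ < α^(c-1)`. -/
def paramSpace (c p : ℕ) : Set (Param c p) :=
  {θ | (∀ j, 0 < θ.fst j) ∧ StrictMono (fun j => θ.fst j)}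

/-- The thresholds `α⁰ = -∞`, `α¹ = 0`, `α^j` for `2 ≤ j ≤ c - 1`, and `α^c = +∞`.
The coordinate `j` of `θ.fst` (counted from `0`) is `α^(j+2)`. -/
def threshold {c p : ℕ} (θ : Param c p) (j : ℕ) : EReal :=
  if j = 0 then ⊥
  else if h : c ≤ j then ⊤
  else if h' : j ≤ 1 then 0
  else ((θ.fst ⟨j - 2, by omega⟩ : ℝ) : EReal)

/-- The extension of a distribution function to `[-∞, ∞]` by `F (-∞) = 0` and `F (+∞) = 1`. -/
def extend (F : ℝ → ℝ) (z : EReal) : ℝ :=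
  if z = ⊥ then 0 else if z = ⊤ then 1 else F z.toReal

/-- `P (y ≤ j | x) = F (α^j + βᵀx)`. -/
def cumProb {c p : ℕ} (F : ℝ → ℝ) (θ : Param c p) (x : EuclideanSpace ℝ (Fin p)) (j : ℕ) : ℝ :=
  extend F (threshold θ j + ((inner ℝ θ.snd x : ℝ) : EReal))

/-- The density `p (x, y | θ) = F (α^y + βᵀx) - F (α^(y-1) + βᵀx)`. The set of categories
`{1, …, c}` is represented by `Fin c`: the element `y : Fin c` is the category `y + 1`. -/
def density {c p : ℕ} (F : ℝ → ℝ) (θ : Param c p) (z : EuclideanSpace ℝ (Fin p) × Fin c) : ℝ :=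
  cumProb F θ z.1 (z.2 + 1) - cumProb F θ z.1 z.2

/-- The law `P (dx dy | θ)` of one observation: it has density `p (x, y | θ)` with respect to
`ν = P_X ⊗ (counting measure)`. -/
def law {c p : ℕ} (PX : Measure (EuclideanSpace ℝ (Fin p))) (F : ℝ → ℝ) (θ : Param c p) :
    Measure (EuclideanSpace ℝ (Fin p) × Fin c) :=
  (PX.prod Measure.count).withDensity (fun z => ENNReal.ofReal (density F θ z))

/-- The vector `ξ = (1, xᵀ)ᵀ`. -/
def withIntercept {p : ℕ} (x : EuclideanSpace ℝ (Fin p)) : EuclideanSpace ℝ (Fin (p + 1)) :=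
  WithLp.toLp 2 (Fin.cons (1 : ℝ) (fun i => x i))

/-- `F` is given by a continuous strictly positive density, and the support of the law `P_ξ` of
`ξ = (1, xᵀ)ᵀ` is compact and contained in no linear subspace of dimension less than `p + 1`. -/
structure Regular {p : ℕ} (PX : Measure (EuclideanSpace ℝ (Fin p))) (F : ℝ → ℝ) : Prop where
  density : ∃ f : ℝ → ℝ, Continuous f ∧ (∀ x, 0 < f x) ∧ Integrable f ∧
    ∀ x, F x = ∫ y in Iic x, f y
  compact : IsCompact (PX.map withIntercept).support
  nondegenerate : ∀ S : Submodule ℝ (EuclideanSpace ℝ (Fin (p + 1))),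
    (PX.map withIntercept).support ⊆ (S : Set (EuclideanSpace ℝ (Fin (p + 1)))) →
      ¬ Module.finrank ℝ S < p + 1

/-- `(ψ_n)` is a uniformly consistent test of `θ₀` against `A` for independent observations from
`P θ`: each `ψ_n` is a measurable `[0, 1]`-valued function of `n` observations, and both
`∫ ψ_n dP_n(· | θ₀)` and `sup_{θ ∈ A} ∫ (1 - ψ_n) dP_n(· | θ)` tend to `0`, where
`P_n(· | θ)` is the `n`-fold product of `P θ`. -/
structure IsUniformlyConsistentTest {T E : Type*} [MeasurableSpace E] (P : T → Measure E)
    (θ₀ : T) (A : Set T) (ψ : (n : ℕ) → (Fin n → E) → ℝ) : Prop where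
  measurable : ∀ n, Measurable (ψ n)
  mem_Icc : ∀ n z, ψ n z ∈ Icc (0 : ℝ) 1
  null : Tendsto (fun n => ∫ z, ψ n z ∂(Measure.pi fun _ : Fin n => P θ₀)) atTop (𝓝 0)
  alternative : Tendsto
    (fun n => ⨆ θ : A, ∫ z, (1 - ψ n z) ∂(Measure.pi fun _ : Fin n => P (θ : T))) atTop (𝓝 0)

end CumulativeLink

end

namespace CumulativeLink

/-! For `1 ≤ j < c` the predictor `α^j + βᵀx` is `⟨w_j, ξ⟩` with `w_j = (α^j, β)`. If `θ` is far
from `θ₀`, some `w_j` is far from its value at `θ₀` (`exists_le_norm_coefVec_sub`). The support of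
`ξ` spans, so one of finitely many support points detects the difference `w` of these vectors: `|⟨w,
ξ⟩| ≥ C‖w‖` (`exists_finset_mul_norm_le_abs_inner`). On the ball of radius `C / 2` about that point
the predictor is still shifted, with constant sign, by at least a fixed `η`. As `F` is strictly
increasing and the ball has positive mass, the probability of {`ξ` in the ball, `y ≤ j`} changes by
an amount bounded below in terms of `θ₀` alone (`exists_separating_events`); hence no compactness of
`Θ` is needed. The test rejects when one of these finitely many empirical frequencies is off, and
Chebyshev makes both errors `O(1/n)`, uniformly in `θ`. -/

/-! ### Tests from finitely many separating events. -/

/-- The number of the observations `z₁, …, zₙ` that fall in `S`. -/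
noncomputable def hitCount {E : Type*} (S : Set E) {n : ℕ} (z : Fin n → E) : ℝ :=
  ∑ i, S.indicator (fun _ => (1 : ℝ)) (z i)

lemma measurable_hitCount {E : Type*} [MeasurableSpace E] {S : Set E} (hS : MeasurableSet S)
    (n : ℕ) : Measurable (hitCount S : (Fin n → E) → ℝ) :=
  Finset.measurable_sum _ fun i _ =>
    (measurable_const.indicator hS).comp (measurable_pi_apply i)

/-- Chebyshev's inequality for the empirical frequency of a set. -/
lemma measureReal_pi_hitCount_le {E : Type*} [MeasurableSpace E] (μ : Measure E)
    [IsProbabilityMeasure μ] {S : Set E} (hS : MeasurableSet S) {n : ℕ} (hn : 0 < n) {t : ℝ}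
    (ht : 0 < t) :
    (Measure.pi fun _ : Fin n => μ).real {z | n * t ≤ |hitCount S z - n * μ.real S|}
      ≤ 1 / (n * t ^ 2) := by
  have hn' : (0 : ℝ) < n := by exact_mod_cast hn
  have hm : Measurable (S.indicator (fun _ => (1 : ℝ))) := measurable_const.indicator hS
  have hb : ∀ x, S.indicator (fun _ => (1 : ℝ)) x ∈ Icc (0 : ℝ) 1 := fun x => by
    by_cases hx : x ∈ S <;> simp [hx]
  have hL : MemLp (S.indicator (fun _ => (1 : ℝ))) 2 μ :=
    memLp_of_bounded (ae_of_all _ hb) hm.aestronglyMeasurable 2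
  have hLi : ∀ i : Fin n, MemLp (fun z : Fin n → E => S.indicator (fun _ => (1 : ℝ)) (z i)) 2
      (Measure.pi fun _ : Fin n => μ) := fun i =>
    hL.comp_measurePreserving (measurePreserving_eval (fun _ : Fin n => μ) i)
  have hcount : (hitCount S : (Fin n → E) → ℝ)
      = ∑ i, fun z : Fin n → E => S.indicator (fun _ => (1 : ℝ)) (z i) := by
    ext z; simp [hitCount]
  have hmean : ∫ z, hitCount S z ∂(Measure.pi fun _ : Fin n => μ) = n * μ.real S := by
    unfold hitCount
    rw [integral_finsetSum _ fun i _ => (hLi i).integrable (by norm_num)]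
    have : ∀ i : Fin n, ∫ z : Fin n → E, S.indicator (fun _ => (1 : ℝ)) (z i)
        ∂(Measure.pi fun _ : Fin n => μ) = μ.real S := fun i => by
      have h := integral_map (μ := Measure.pi fun _ : Fin n => μ)
        (measurable_pi_apply i).aemeasurable (f := S.indicator (fun _ => (1 : ℝ)))
        hm.aestronglyMeasurable
      rw [(measurePreserving_eval (fun _ : Fin n => μ) i).map_eq] at h
      rw [← h, integral_indicator hS]
      simp
    simp [this]
  -- Independence adds the variances, and each indicator contributes at most `1/4`; the cruder bound
  -- `1` suffices.
  have hvar : Var[hitCount S; Measure.pi fun _ : Fin n => μ] ≤ n := by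
    rw [hcount, variance_sum_pi (X := fun _ => S.indicator (fun _ => (1 : ℝ))) fun _ => hL]
    have h1 : Var[S.indicator (fun _ => (1 : ℝ)); μ] ≤ 1 :=
      (variance_le_sq_of_bounded (ae_of_all _ hb) hm.aemeasurable).trans (by norm_num)
    simpa using mul_le_mul_of_nonneg_left h1 hn'.le
  have hLc : MemLp (hitCount S) 2 (Measure.pi fun _ : Fin n => μ) := by
    rw [hcount]; exact memLp_finsetSum' _ fun i _ => hLi i
  have key := meas_ge_le_variance_div_sq hLc (mul_pos hn' ht)
  rw [hmean] at key
  have h2 := ENNReal.toReal_mono ENNReal.ofReal_ne_top key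
  rw [ENNReal.toReal_ofReal (div_nonneg (variance_nonneg _ _) (sq_nonneg _))] at h2
  refine h2.trans ?_
  rw [div_le_div_iff₀ (by positivity) (by positivity)]
  nlinarith [mul_le_mul_of_nonneg_right hvar (by positivity : (0 : ℝ) ≤ n * t ^ 2)]

/-- If finitely many events separate `P θ₀` from all `P θ`, `θ ∈ A`, by a uniform margin, then
there is a uniformly consistent test of `θ₀` against `A`. -/
lemma exists_isUniformlyConsistentTest {T E K : Type*} [MeasurableSpace E] [Fintype K]
    (P : T → Measure E) (θ₀ : T) (A : Set T) [IsProbabilityMeasure (P θ₀)]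
    (hA : ∀ θ ∈ A, IsProbabilityMeasure (P θ)) (S : K → Set E) (hS : ∀ k, MeasurableSet (S k))
    {δ : ℝ} (hδ : 0 < δ)
    (hsep : ∀ θ ∈ A, ∃ k, δ ≤ |(P θ).real (S k) - (P θ₀).real (S k)|) :
    ∃ ψ : (n : ℕ) → (Fin n → E) → ℝ, IsUniformlyConsistentTest P θ₀ A ψ := by
  let D : (n : ℕ) → K → Set (Fin n → E) := fun n k =>
    {z | n * (δ / 2) ≤ |hitCount (S k) z - n * (P θ₀).real (S k)|}
  have hDm : ∀ n k, MeasurableSet (D n k) := fun n k =>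
    measurableSet_le measurable_const
      (((measurable_hitCount (hS k) n).sub measurable_const).abs)
  let R : (n : ℕ) → Set (Fin n → E) := fun n => ⋃ k, D n k
  have hRm : ∀ n, MeasurableSet (R n) := fun n => MeasurableSet.iUnion (hDm n)
  have hlim : ∀ C : ℝ, Tendsto (fun n : ℕ => C * (1 / (n * (δ / 2) ^ 2))) atTop (𝓝 0) := by
    intro C
    have h := (tendsto_one_div_atTop_nhds_zero_nat (𝕜 := ℝ)).const_mul (C / (δ / 2) ^ 2)
    rw [mul_zero] at h
    refine h.congr fun n => ?_
    simp only [mul_inv, div_eq_mul_inv]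
    ring
  refine ⟨fun n => (R n).indicator fun _ => 1, ?_, ?_, ?_, ?_⟩
  · exact fun n => measurable_const.indicator (hRm n)
  · intro n z
    by_cases hz : z ∈ R n <;> simp [hz]
  · refine squeeze_zero' (.of_forall fun n => ?_) ?_ (hlim (Fintype.card K))
    · exact integral_nonneg fun z => indicator_nonneg (fun _ _ => zero_le_one) z
    filter_upwards [eventually_gt_atTop 0] with n hn
    rw [integral_indicator (hRm n)]
    simp only [integral_const, smul_eq_mul, mul_one, measureReal_restrict_apply_univ]
    refine (measureReal_iUnion_fintype_le _).trans ?_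
    refine (Finset.sum_le_sum fun k _ =>
      measureReal_pi_hitCount_le (P θ₀) (hS k) hn (half_pos hδ)).trans ?_
    simp
  · refine squeeze_zero' (.of_forall fun n => ?_) ?_ (hlim 1)
    · refine Real.iSup_nonneg fun θ => integral_nonneg fun z => ?_
      by_cases hz : z ∈ R n <;> simp [hz]
    filter_upwards [eventually_gt_atTop 0] with n hn
    -- The bound must be nonnegative because the supremum is `0` when `A` is empty.
    refine Real.iSup_le (fun θ => ?_) (by positivity)
    have := hA θ θ.2
    have hc : (fun z => 1 - (R n).indicator (fun _ => (1 : ℝ)) z)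
        = (R n)ᶜ.indicator fun _ => 1 := by
      ext z
      by_cases hz : z ∈ R n <;> simp [hz]
    rw [hc, integral_indicator (hRm n).compl]
    simp only [integral_const, smul_eq_mul, mul_one, measureReal_restrict_apply_univ, one_mul]
    obtain ⟨k, hk⟩ := hsep θ θ.2
    -- Acceptance puts the frequency of `S k` within `δ / 2` of its value under `θ₀`, hence at least
    -- `δ / 2` from its value under `θ`.
    refine le_trans (measureReal_mono fun z hz => ?_)
      (measureReal_pi_hitCount_le (P θ) (hS k) hn (half_pos hδ))
    have hz' : |hitCount (S k) z - n * (P θ₀).real (S k)| < n * (δ / 2) := by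
      by_contra h
      exact hz (mem_iUnion.2 ⟨k, not_lt.1 h⟩)
    have hn' : (0 : ℝ) < n := by exact_mod_cast hn
    have h1 : n * δ ≤ |n * (P θ).real (S k) - n * (P θ₀).real (S k)| := by
      rw [← mul_sub, abs_mul, abs_of_pos hn']
      exact mul_le_mul_of_nonneg_left hk hn'.le
    have h2 := abs_sub_le (n * (P θ).real (S k)) (hitCount (S k) z) (n * (P θ₀).real (S k))
    rw [abs_sub_comm (n * (P θ).real (S k)) (hitCount (S k) z)] at h2
    change n * (δ / 2) ≤ |hitCount (S k) z - n * (P θ).real (S k)|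
    linarith

/-! ### Norm control by finitely many inner products. -/

/-- A set spanning a finite-dimensional inner product space contains finitely many vectors that
control the norm through inner products. -/
lemma exists_finset_mul_norm_le_abs_inner {E : Type*} [NormedAddCommGroup E]
    [InnerProductSpace ℝ E] [FiniteDimensional ℝ E] {s : Set E} (hs : Submodule.span ℝ s = ⊤) :
    ∃ t : Finset E, ↑t ⊆ s ∧ ∃ C > 0, ∀ w : E, w ≠ 0 → ∃ ξ ∈ t, C * ‖w‖ ≤ |inner ℝ w ξ| := by
  obtain ⟨t, hts, ht⟩ := (Submodule.fg_span_iff_fg_span_finset_subset (R := ℝ) s).1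
    (IsNoetherian.noetherian _)
  rw [hs] at ht
  let f : E →ₗ[ℝ] (t → ℝ) := LinearMap.pi fun ξ => innerₗ E (ξ : E)
  have hf : LinearMap.ker f = ⊥ := by
    refine (LinearMap.ker_eq_bot').2 fun w hw => ?_
    have h : ∀ ξ ∈ t, inner ℝ ξ w = 0 := fun ξ hξ => congrFun hw ⟨ξ, hξ⟩
    have hmem : w ∈ Submodule.span ℝ (t : Set E) := ht ▸ Submodule.mem_top
    have h0 : ∀ x ∈ Submodule.span ℝ (t : Set E), inner ℝ x w = 0 := fun x hx => by
      induction hx using Submodule.span_induction with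
      | mem x hx => exact h x hx
      | zero => simp
      | add x y _ _ hx hy => rw [inner_add_left, hx, hy, add_zero]
      | smul a x _ hx => rw [real_inner_smul_left, hx, mul_zero]
    exact inner_self_eq_zero.1 (h0 w hmem)
  -- An injective linear map in finite dimension is bounded below; the sup norm on `t → ℝ` then
  -- singles out one vector `ξ`.
  obtain ⟨K, hK, hL⟩ := f.exists_antilipschitzWith hf
  refine ⟨t, hts, (K : ℝ)⁻¹, by positivity, fun w hw => ?_⟩
  by_contra! hlt
  have h1 : ‖f w‖ < (K : ℝ)⁻¹ * ‖w‖ := by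
    have hw' := norm_pos_iff.2 hw
    refine (pi_norm_lt_iff (by positivity)).2 fun ξ => ?_
    have := hlt ξ ξ.2
    rwa [real_inner_comm] at this
  have h2 := hL.le_mul_dist w 0
  rw [map_zero, dist_zero_right, dist_zero_right] at h2
  rw [lt_inv_mul_iff₀ (by exact_mod_cast hK)] at h1
  linarith

/-! ### Thresholds, cumulative probabilities and the law of one observation. -/

variable {c p : ℕ}

lemma threshold_zero (θ : Param c p) : threshold θ 0 = ⊥ := by simp [threshold]

lemma threshold_of_le (hc : 2 ≤ c) (θ : Param c p) {j : ℕ} (hj : c ≤ j) :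
    threshold θ j = ⊤ := by
  have : j ≠ 0 := by omega
  simp [threshold, this, hj]

/-- `toReal` sends `⊥` and `⊤` to `0`, so real thresholds are faithful only for these indices. -/
lemma coe_toReal_threshold (θ : Param c p) {j : ℕ} (hj : 1 ≤ j) (hjc : j < c) :
    (((threshold θ j).toReal : ℝ) : EReal) = threshold θ j := by
  have h0 : j ≠ 0 := by omega
  by_cases h1 : j ≤ 1
  · simp [threshold, h0, hjc.not_ge, h1]
  · simp [threshold, h0, hjc.not_ge, h1]

lemma threshold_one (hc : 2 ≤ c) (θ : Param c p) : threshold θ 1 = 0 := by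
  have : ¬ c ≤ 1 := by omega
  simp [threshold, this]

lemma threshold_add_two (θ : Param c p) (i : Fin (c - 2)) :
    threshold θ (i + 2) = ((θ.fst i : ℝ) : EReal) := by
  have : ¬ c ≤ i + 2 := by omega
  simp [threshold, this]

lemma threshold_mono (hc : 2 ≤ c) {θ : Param c p} (hθ : θ ∈ paramSpace c p) :
    Monotone (threshold θ) := by
  refine monotone_nat_of_le_succ fun j => ?_
  rcases Nat.eq_zero_or_pos j with rfl | hj
  · rw [threshold_zero]; exact bot_le
  rcases le_or_gt c (j + 1) with h | h
  · rw [threshold_of_le hc θ h]; exact le_top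
  obtain ⟨i, hi⟩ : ∃ i : Fin (c - 2), j + 1 = i + 2 := ⟨⟨j - 1, by omega⟩, by simp; omega⟩
  rw [hi, threshold_add_two]
  rcases Nat.lt_or_ge j 2 with h2 | h2
  · obtain rfl : j = 1 := by omega
    rw [threshold_one hc]
    exact_mod_cast (hθ.1 i).le
  obtain ⟨k, hk⟩ : ∃ k : Fin (c - 2), j = k + 2 := ⟨⟨j - 2, by omega⟩, by simp; omega⟩
  rw [hk, threshold_add_two]
  refine EReal.coe_le_coe_iff.2 (hθ.2.monotone ?_)
  rw [Fin.le_def]; omega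

lemma extend_coe (F : ℝ → ℝ) (a : ℝ) : extend F (a : EReal) = F a := by
  simp [extend]

lemma extend_mono {F : ℝ → ℝ} (hF : Monotone F) (h0 : ∀ x, 0 ≤ F x) (h1 : ∀ x, F x ≤ 1) :
    Monotone (extend F) := by
  intro a b hab
  induction a with
  | bot =>
    induction b with
    | bot => exact le_rfl
    | coe b => simpa [extend] using h0 b
    | top => simp [extend]
  | coe a =>
    induction b with
    | bot => simp at hab
    | coe b => simpa [extend] using hF (EReal.coe_le_coe_iff.1 hab)
    | top => simpa [extend] using h1 a
  | top =>
    obtain rfl := top_le_iff.1 hab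
    exact le_rfl

lemma cumProb_zero (F : ℝ → ℝ) (θ : Param c p) (x : EuclideanSpace ℝ (Fin p)) :
    cumProb F θ x 0 = 0 := by
  simp [cumProb, threshold_zero, extend]

lemma cumProb_of_le (hc : 2 ≤ c) (F : ℝ → ℝ) (θ : Param c p) (x : EuclideanSpace ℝ (Fin p))
    {j : ℕ} (hj : c ≤ j) : cumProb F θ x j = 1 := by
  simp [cumProb, threshold_of_le hc θ hj, extend]

lemma cumProb_eq (F : ℝ → ℝ) (θ : Param c p) (x : EuclideanSpace ℝ (Fin p)) {j : ℕ}
    (hj : 1 ≤ j) (hjc : j < c) :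
    cumProb F θ x j = F ((threshold θ j).toReal + inner ℝ θ.snd x) := by
  rw [cumProb, ← coe_toReal_threshold θ hj hjc, ← EReal.coe_add, extend_coe]
  simp

lemma cumProb_mono (hc : 2 ≤ c) {F : ℝ → ℝ} (hF : Monotone F) (h0 : ∀ x, 0 ≤ F x)
    (h1 : ∀ x, F x ≤ 1) {θ : Param c p} (hθ : θ ∈ paramSpace c p)
    (x : EuclideanSpace ℝ (Fin p)) : Monotone (cumProb F θ x) := fun _ _ hij =>
  extend_mono hF h0 h1 (add_le_add (threshold_mono hc hθ hij) le_rfl)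

lemma measurable_cumProb (hc : 2 ≤ c) {F : ℝ → ℝ} (hF : Monotone F) (θ : Param c p) (j : ℕ) :
    Measurable fun x => cumProb F θ x j := by
  rcases Nat.eq_zero_or_pos j with rfl | hj
  · simp [cumProb_zero]
  rcases le_or_gt c j with h | h
  · simp [cumProb_of_le hc F θ _ h]
  simp only [cumProb_eq F θ _ hj h]
  exact hF.measurable.comp (by fun_prop)

lemma measurable_density (hc : 2 ≤ c) {F : ℝ → ℝ} (hF : Monotone F) (θ : Param c p) :
    Measurable (density F θ) :=
  measurable_from_prod_countable_left fun y =>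
    (measurable_cumProb hc hF θ (y + 1)).sub (measurable_cumProb hc hF θ y)

/-- The sum telescopes; as `y : Fin c` is category `y + 1`, the condition `y < j` selects the
categories up to `j`. -/
lemma sum_density_of_lt (F : ℝ → ℝ) (θ : Param c p) (x : EuclideanSpace ℝ (Fin p)) {j : ℕ}
    (hj : j ≤ c) : ∑ y : Fin c, (if (y : ℕ) < j then density F θ (x, y) else 0)
      = cumProb F θ x j := by
  simp only [density]
  rw [Fin.sum_univ_eq_sum_range
    (fun y => if y < j then cumProb F θ x (y + 1) - cumProb F θ x y else 0) c,
    ← Finset.sum_filter]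
  have : (Finset.range c).filter (· < j) = Finset.range j := by
    ext i; simp; omega
  rw [this, Finset.sum_range_sub, cumProb_zero, sub_zero]

/-- `P (x ∈ A, y ≤ j | θ) = ∫_A P (y ≤ j | x) dP_X`. -/
lemma law_prod (hc : 2 ≤ c) (PX : Measure (EuclideanSpace ℝ (Fin p))) [IsProbabilityMeasure PX]
    {F : ℝ → ℝ} (hF : Monotone F) (h0 : ∀ x, 0 ≤ F x) (h1 : ∀ x, F x ≤ 1)
    {θ : Param c p} (hθ : θ ∈ paramSpace c p) {A : Set (EuclideanSpace ℝ (Fin p))}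
    (hA : MeasurableSet A) {j : ℕ} (hj : j ≤ c) :
    law PX F θ (A ×ˢ {y : Fin c | (y : ℕ) < j})
      = ∫⁻ x in A, ENNReal.ofReal (cumProb F θ x j) ∂PX := by
  have hB : MeasurableSet {y : Fin c | (y : ℕ) < j} := MeasurableSet.of_discrete
  have hd := (measurable_density hc hF θ).ennreal_ofReal
  rw [law, withDensity_apply _ (hA.prod hB), ← Measure.prod_restrict,
    lintegral_prod _ hd.aemeasurable]
  refine lintegral_congr fun x => ?_
  rw [← lintegral_indicator hB, lintegral_count, tsum_fintype,
    ← sum_density_of_lt F θ x hj, ENNReal.ofReal_sum_of_nonneg]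
  · refine Finset.sum_congr rfl fun y _ => ?_
    by_cases hy : (y : ℕ) < j <;> simp [hy]
  · intro y _
    split_ifs
    · exact sub_nonneg.2 (cumProb_mono hc hF h0 h1 hθ x (Nat.le_succ _))
    · exact le_rfl

lemma isProbabilityMeasure_law (hc : 2 ≤ c) (PX : Measure (EuclideanSpace ℝ (Fin p)))
    [IsProbabilityMeasure PX] {F : ℝ → ℝ} (hF : Monotone F) (h0 : ∀ x, 0 ≤ F x)
    (h1 : ∀ x, F x ≤ 1) {θ : Param c p} (hθ : θ ∈ paramSpace c p) :
    IsProbabilityMeasure (law PX F θ) := by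
  refine ⟨?_⟩
  have h := law_prod hc PX hF h0 h1 hθ MeasurableSet.univ le_rfl
  have hu : (univ : Set (EuclideanSpace ℝ (Fin p))) ×ˢ {y : Fin c | (y : ℕ) < c} = univ := by
    ext z; simp
  rw [hu] at h
  simpa [cumProb_of_le hc] using h

lemma law_real_prod (hc : 2 ≤ c) (PX : Measure (EuclideanSpace ℝ (Fin p)))
    [IsProbabilityMeasure PX] {F : ℝ → ℝ} (hF : Monotone F) (h0 : ∀ x, 0 ≤ F x)
    (h1 : ∀ x, F x ≤ 1) {θ : Param c p} (hθ : θ ∈ paramSpace c p)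
    {A : Set (EuclideanSpace ℝ (Fin p))} (hA : MeasurableSet A) {j : ℕ} (hj : 1 ≤ j)
    (hjc : j < c) :
    (law PX F θ).real (A ×ˢ {y : Fin c | (y : ℕ) < j})
      = ∫ x in A, F ((threshold θ j).toReal + inner ℝ θ.snd x) ∂PX := by
  rw [Measure.real, law_prod hc PX hF h0 h1 hθ hA hjc.le, ← integral_toReal]
  · refine integral_congr_ae (.of_forall fun x => ?_)
    simp only [cumProb_eq F θ x hj hjc, ENNReal.toReal_ofReal (h0 _)]
  · exact (measurable_cumProb hc hF θ j).ennreal_ofReal.aemeasurable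
  · exact .of_forall fun x => ENNReal.ofReal_lt_top

/-! ### Coefficient vectors and the distance on parameters. -/

/-- The vector `(α^j, β)`, so that `α^j + βᵀx` is its inner product with `ξ = (1, x)`. -/
noncomputable def coefVec (θ : Param c p) (j : ℕ) : EuclideanSpace ℝ (Fin (p + 1)) :=
  WithLp.toLp 2 (Fin.cons (threshold θ j).toReal fun i => θ.snd i)

lemma inner_coefVec (θ : Param c p) (j : ℕ) (x : EuclideanSpace ℝ (Fin p)) :
    inner ℝ (coefVec θ j) (withIntercept x)
      = (threshold θ j).toReal + inner ℝ θ.snd x := by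
  simp [coefVec, withIntercept, PiLp.inner_apply, Fin.sum_univ_succ]

lemma norm_sq_coefVec_sub (θ θ₀ : Param c p) (j : ℕ) :
    ‖coefVec θ j - coefVec θ₀ j‖ ^ 2
      = ((threshold θ j).toReal - (threshold θ₀ j).toReal) ^ 2 + ‖θ.snd - θ₀.snd‖ ^ 2 := by
  simp [coefVec, EuclideanSpace.real_norm_sq_eq, Fin.sum_univ_succ]

/-- Otherwise the `c - 2` threshold differences and the difference of the `β` are each at most `ε`,
so the squared distance is at most `(c - 1) * ε ^ 2 < c * ε ^ 2`. Index `0`, where `α¹ = 0`,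
controls `β` even when `c = 2`. -/
lemma exists_le_norm_coefVec_sub (hc : 2 ≤ c) {θ θ₀ : Param c p} {ε : ℝ}
    (h : Real.sqrt c * ε ≤ dist θ θ₀) (hε : 0 < ε) :
    ∃ j : Fin (c - 1), ε ≤ ‖coefVec θ (j + 1) - coefVec θ₀ (j + 1)‖ := by
  by_contra! hlt
  have hsq : ∀ j : Fin (c - 1), ((threshold θ (j + 1)).toReal - (threshold θ₀ (j + 1)).toReal) ^ 2
      + ‖θ.snd - θ₀.snd‖ ^ 2 < ε ^ 2 := fun j => by
    rw [← norm_sq_coefVec_sub]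
    exact pow_lt_pow_left₀ (hlt j) (norm_nonneg _) two_ne_zero
  have hβ : ‖θ.snd - θ₀.snd‖ ^ 2 < ε ^ 2 :=
    lt_of_le_of_lt (le_add_of_nonneg_left (sq_nonneg _)) (hsq ⟨0, by omega⟩)
  have hα : ‖θ.fst - θ₀.fst‖ ^ 2 ≤ (c - 2 : ℕ) * ε ^ 2 := by
    rw [EuclideanSpace.real_norm_sq_eq]
    refine (Finset.sum_le_card_nsmul _ _ (ε ^ 2) fun i _ => ?_).trans (by simp)
    have := hsq ⟨i + 1, by omega⟩
    simp only [add_assoc, Nat.reduceAdd, threshold_add_two, EReal.toReal_coe] at this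
    simp only [PiLp.sub_apply]
    nlinarith [sq_nonneg ‖θ.snd - θ₀.snd‖]
  have hd : dist θ θ₀ ^ 2 = ‖θ.fst - θ₀.fst‖ ^ 2 + ‖θ.snd - θ₀.snd‖ ^ 2 := by
    rw [dist_eq_norm, WithLp.prod_norm_sq_eq_of_L2]
    rfl
  have h2 := pow_le_pow_left₀ (by positivity) h 2
  rw [mul_pow, Real.sq_sqrt (Nat.cast_nonneg c), hd] at h2
  rw [Nat.cast_sub hc] at hα
  push_cast at hα
  nlinarith

/-! ### Consequences of regularity, and the separating events. -/

lemma continuous_withIntercept :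
    Continuous (withIntercept : EuclideanSpace ℝ (Fin p) → EuclideanSpace ℝ (Fin (p + 1))) := by
  refine (PiLp.continuous_toLp 2 _).comp (continuous_pi fun i => ?_)
  refine Fin.cases ?_ (fun i => ?_) i
  · simpa using continuous_const
  · simp only [Fin.cons_succ]; fun_prop

lemma setIntegral_pos_of_pos {α : Type*} [MeasurableSpace α] {μ : Measure α} {A : Set α}
    {g : α → ℝ} (hg : ∀ x, 0 < g x) (hi : IntegrableOn g A μ) (hA : 0 < μ A) :
    0 < ∫ x in A, g x ∂μ := by
  rw [setIntegral_pos_iff_support_of_nonneg_ae (.of_forall fun x => (hg x).le) hi]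
  have : Function.support g = univ := by ext x; simpa using (hg x).ne'
  rwa [this, univ_inter]

lemma Regular.span_support {PX : Measure (EuclideanSpace ℝ (Fin p))} {F : ℝ → ℝ}
    (h : Regular PX F) : Submodule.span ℝ (PX.map withIntercept).support = ⊤ := by
  by_contra hne
  refine h.nondegenerate _ Submodule.subset_span ?_
  simpa using Submodule.finrank_lt hne

lemma Regular.strictMono {PX : Measure (EuclideanSpace ℝ (Fin p))} {F : ℝ → ℝ}
    (h : Regular PX F) : StrictMono F := by
  obtain ⟨f, -, hpos, hint, hF⟩ := h.density
  intro a b hab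
  have h1 : 0 < ∫ y in Ioc a b, f y :=
    setIntegral_pos_of_pos hpos hint.integrableOn (by simpa using hab)
  have h2 := setIntegral_union (μ := volume) (f := f) (s := Iic a) (t := Ioc a b)
    (Set.Iic_disjoint_Ioc le_rfl) measurableSet_Ioc hint.integrableOn hint.integrableOn
  rw [Iic_union_Ioc_eq_Iic hab.le, ← hF, ← hF] at h2
  linarith

lemma measure_preimage_withIntercept_ball_pos {PX : Measure (EuclideanSpace ℝ (Fin p))}
    {ξ : EuclideanSpace ℝ (Fin (p + 1))} (hξ : ξ ∈ (PX.map withIntercept).support) {r : ℝ}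
    (hr : 0 < r) : 0 < PX (withIntercept ⁻¹' Metric.ball ξ r) := by
  rw [← Measure.map_apply continuous_withIntercept.measurable measurableSet_ball]
  exact (Measure.mem_support_iff_forall ξ).1 hξ _ (Metric.ball_mem_nhds ξ hr)

/-- Finitely many events `{x ∈ A, y ≤ j}` separate `θ₀` from the parameters at distance at least
`ε`, by a uniform margin. -/
lemma exists_separating_events (hc : 2 ≤ c) (PX : Measure (EuclideanSpace ℝ (Fin p)))
    [IsProbabilityMeasure PX] {F : ℝ → ℝ} (h : Regular PX F) (h0 : ∀ x, 0 ≤ F x)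
    (h1 : ∀ x, F x ≤ 1) {θ₀ : Param c p} (hθ₀ : θ₀ ∈ paramSpace c p) {ε : ℝ} (hε : 0 < ε) :
    ∃ (t : Finset (EuclideanSpace ℝ (Fin (p + 1)))) (S : Fin (c - 1) × t →
      Set (EuclideanSpace ℝ (Fin p) × Fin c)) (δ : ℝ), 0 < δ ∧ (∀ k, MeasurableSet (S k)) ∧
      ∀ θ ∈ paramSpace c p \ Metric.ball θ₀ ε,
        ∃ k, δ ≤ |(law PX F θ).real (S k) - (law PX F θ₀).real (S k)| := by
  have hF := h.strictMono
  obtain ⟨t, hts, C, hC, ht⟩ := exists_finset_mul_norm_le_abs_inner h.span_support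
  have hc0 : (0 : ℝ) < Real.sqrt c := Real.sqrt_pos.2 (by exact_mod_cast (by omega : 0 < c))
  set ε' := ε / Real.sqrt c with hε'
  have hε'0 : 0 < ε' := div_pos hε hc0
  set η := C / 2 * ε' with hη
  have hη0 : 0 < η := by positivity
  let A : t → Set (EuclideanSpace ℝ (Fin p)) := fun ξ =>
    withIntercept ⁻¹' Metric.ball (ξ : EuclideanSpace ℝ (Fin (p + 1))) (C / 2)
  have hAm : ∀ ξ, MeasurableSet (A ξ) := fun ξ =>
    continuous_withIntercept.measurable measurableSet_ball
  have hA0 : ∀ ξ, 0 < PX (A ξ) := fun ξ =>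
    measure_preimage_withIntercept_ball_pos (hts ξ.2) (half_pos hC)
  let l : Param c p → Fin (c - 1) → EuclideanSpace ℝ (Fin p) → ℝ := fun θ j x =>
    inner ℝ (coefVec θ (j + 1)) (withIntercept x)
  have hl : ∀ θ j, Measurable (l θ j) := fun θ j => by
    simp only [l, inner_coefVec]; fun_prop
  have hint : ∀ (g : EuclideanSpace ℝ (Fin p) → ℝ) (B), Measurable g →
      IntegrableOn (fun x => F (g x)) B PX := fun g B hg =>
    Integrable.of_bound (hF.monotone.measurable.comp hg).aestronglyMeasurable 1
      (.of_forall fun x => by rw [Real.norm_of_nonneg (h0 _)]; exact h1 _)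
  -- `up` and `dn` are the probability changes caused by shifting the predictor by exactly `±η`;
  -- they do not involve `θ`.
  let up : Fin (c - 1) × t → ℝ := fun k =>
    ∫ x in A k.2, (F (l θ₀ k.1 x + η) - F (l θ₀ k.1 x)) ∂PX
  let dn : Fin (c - 1) × t → ℝ := fun k =>
    ∫ x in A k.2, (F (l θ₀ k.1 x) - F (l θ₀ k.1 x - η)) ∂PX
  have hup : ∀ k, 0 < up k := fun k =>
    setIntegral_pos_of_pos (fun x => sub_pos.2 (hF (lt_add_of_pos_right _ hη0)))
      ((hint _ _ ((hl _ _).add_const η)).sub (hint _ _ (hl _ _))) (hA0 _)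
  have hdn : ∀ k, 0 < dn k := fun k =>
    setIntegral_pos_of_pos (fun x => sub_pos.2 (hF (sub_lt_self _ hη0)))
      ((hint _ _ (hl _ _)).sub (hint _ _ ((hl _ _).sub_const η))) (hA0 _)
  obtain ⟨δ, hδ, hδk⟩ : ∃ δ : ℝ, 0 < δ ∧ ∀ k, δ < min (up k) (dn k) := by
    simpa using Pi.exists_forall_pos_add_lt (x := fun _ => (0 : ℝ))
      fun k => lt_min (hup k) (hdn k)
  have hlaw : ∀ θ ∈ paramSpace c p, ∀ k : Fin (c - 1) × t,
      (law PX F θ).real (A k.2 ×ˢ {y : Fin c | (y : ℕ) < k.1 + 1})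
        = ∫ x in A k.2, F (l θ k.1 x) ∂PX := fun θ hθ k => by
    rw [law_real_prod hc PX hF.monotone h0 h1 hθ (hAm _) (by omega) (by omega)]
    simp only [l, inner_coefVec]
  refine ⟨t, fun k => A k.2 ×ˢ {y : Fin c | (y : ℕ) < k.1 + 1}, δ, hδ,
    fun k => (hAm _).prod MeasurableSet.of_discrete, fun θ hθ => ?_⟩
  have hdist : Real.sqrt c * ε' ≤ dist θ θ₀ := by
    rw [hε', mul_div_cancel₀ _ hc0.ne']
    simpa using hθ.2
  obtain ⟨j, hj⟩ := exists_le_norm_coefVec_sub hc hdist hε'0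
  set w := coefVec θ (j + 1) - coefVec θ₀ (j + 1) with hw
  obtain ⟨ξ, hξt, hξ⟩ := ht w (norm_pos_iff.1 (hε'0.trans_le hj))
  have hsub : ∀ x, inner ℝ w (withIntercept x) = l θ j x - l θ₀ j x := fun x => by
    rw [hw, inner_sub_left]
  -- Moving from `ξ` to a point of the ball costs at most half of `C * ‖w‖`, so a shift of at least
  -- `η` remains.
  have hnear : ∀ x ∈ A ⟨ξ, hξt⟩, |l θ j x - l θ₀ j x - inner ℝ w ξ| ≤ ‖w‖ * (C / 2) :=
    fun x hx => by
    rw [← hsub, ← inner_sub_right]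
    refine (abs_real_inner_le_norm _ _).trans (mul_le_mul_of_nonneg_left ?_ (norm_nonneg _))
    rw [← dist_eq_norm]
    exact (Metric.mem_ball.1 hx).le
  have hηw : η ≤ C * ‖w‖ - ‖w‖ * (C / 2) := by
    rw [hη]; nlinarith
  refine ⟨(j, ⟨ξ, hξt⟩), ?_⟩
  have hk := lt_min_iff.1 (hδk (j, ⟨ξ, hξt⟩))
  rw [hlaw θ hθ.1, hlaw θ₀ hθ₀]
  -- The sign of `⟨w, ξ⟩` decides whether the predictor rises or falls throughout the ball.
  rcases le_total 0 (inner ℝ w ξ) with hs | hs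
  · rw [abs_of_nonneg hs] at hξ
    refine le_trans (hk.1.le.trans ?_) (le_abs_self _)
    simp only [up]
    rw [integral_sub (hint _ _ ((hl _ _).add_const η)) (hint _ _ (hl _ _))]
    refine sub_le_sub_right (setIntegral_mono_on (hint _ _ ((hl _ _).add_const η))
      (hint _ _ (hl _ _)) (hAm _) fun x hx => hF.monotone ?_) _
    have := (abs_le.1 (hnear x hx)).1
    linarith
  · rw [abs_of_nonpos hs] at hξ
    rw [abs_sub_comm]
    refine le_trans (hk.2.le.trans ?_) (le_abs_self _)
    simp only [dn]
    rw [integral_sub (hint _ _ (hl _ _)) (hint _ _ ((hl _ _).sub_const η))]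
    refine sub_le_sub_left (setIntegral_mono_on (hint _ _ (hl _ _))
      (hint _ _ ((hl _ _).sub_const η)) (hAm _) fun x hx => hF.monotone ?_) _
    have := (abs_le.1 (hnear x hx)).2
    linarith

end CumulativeLink

theorem mainTheorem9 (c p : ℕ) (hc : 2 ≤ c)
    (PX : Measure (EuclideanSpace ℝ (Fin p))) [IsProbabilityMeasure PX]
    (Q : Measure ℝ) [IsProbabilityMeasure Q]
    (hreg : CumulativeLink.Regular PX (cdf Q))
    (θ₀ : CumulativeLink.Param c p) (hθ₀ : θ₀ ∈ CumulativeLink.paramSpace c p)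
    (ε : ℝ) (hε : 0 < ε) :
    ∃ ψ : (n : ℕ) → (Fin n → EuclideanSpace ℝ (Fin p) × Fin c) → ℝ,
      CumulativeLink.IsUniformlyConsistentTest (CumulativeLink.law PX (cdf Q)) θ₀
        (CumulativeLink.paramSpace c p \ Metric.ball θ₀ ε) ψ := by
  have hlaw := fun {θ} => CumulativeLink.isProbabilityMeasure_law (θ := θ) hc PX (monotone_cdf Q)
    (cdf_nonneg Q) (cdf_le_one Q)
  have := hlaw hθ₀
  obtain ⟨t, S, δ, hδ, hS, hsep⟩ := CumulativeLink.exists_separating_events hc PX hreg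
    (cdf_nonneg Q) (cdf_le_one Q) hθ₀ hε
  exact CumulativeLink.exists_isUniformlyConsistentTest _ θ₀ _ (fun θ hθ => hlaw hθ.1) S hS hδ hsep
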